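/- **Online matching with additive budgets.** There is a finite set $L$ of offline vertices, each with a budget $W_i>0$. Online vertices $j=1,\dots,n$ arrive one by one, in an order fixed in advance; when $j$ arrives, its weights $w_{ij}\ge 0$ ($i\in L$) are revealed (a missing edge has weight $0$), and $j$ must be assigned irrevocably to at most one $i\in L$. If $M_i$ is the set of online vertices assigned to $i$ in the assignment $M$, the reward of $M$ is $c(M)=\sum_{i\in L}\min\{W_i,\sum_{j\in M_i}w_{ij}\}$. Let $\mathrm{OPT}$ be the maximum of $c$ over all assignments, and let $R_{\max}=\max_{i,j}w_{ij}/W_i$ (with $R_{\max}=0$ if there are no pairs $(i,j)$). Put $$g(y)=\frac{e^{y-1}}{1-1/e},\qquad G(y)=\frac{e^{y-1}-1/e}{1-1/e}.$$ **Algorithm.** Start with $Y_i=B_i=0$ for all $i\in L$. When $j$ arrives, put $$m_{ij}=\min\Bigl\{w_{ij},\ \max\Bigl\{0,\ W_i-\sum_{j'<j\text{ assigned to }i}w_{ij'}\Bigr\}\Bigr\}.$$ If $Y_i\ge 1$ for all $i\in L$, leave $j$ unassigned. Otherwise, starting from $x_{ij}=0$ for all $i$, increase $x_{ij}$ at the same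 rate for all $i$ maximizing $m_{ij}\,(1-B_i/W_i)$ (evaluated in the state before the arrival of $j$) until $\sum_i x_{ij}=1$, and then assign $j$ to one random $i$, namely to $i$ with probability $x_{ij}$. For the chosen $i$ the variables are then updated by letting $x$, the share of $j$ received by $i$, grow from $0$ to $1$, with $$dY_i=\frac{m_{ij}}{W_i}\,dx,\qquad dB_i=m_{ij}\,g(Y_i)\,dx ;$$ for the other $i$ they do not change. **Theorem.** On every instance the random assignment $M$ produced by this algorithm satisfies $$\mathbb E[c(M)]\ \ge\ G(1-R_{\max})\Bigl(1-\frac1e\Bigr)\,\mathrm{OPT},\qquad\text{where}\qquad G(1-R_{\max})\Bigl(1-\frac1e\Bigr)=e^{-R_{\max}}-e^{-1}.$$ That is, the algorithm has competitive ratio $e^{-R_{\max}}-e^{-1}$. -/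

import Mathlib

namespace AdditiveBudget

noncomputable section

/-- `g(y) = e^{y-1} / (1 - 1/e)`. -/
def g (y : ℝ) : ℝ := Real.exp (y - 1) / (1 - 1 / Real.exp 1)

/-- `G(y) = (e^{y-1} - 1/e) / (1 - 1/e)`. -/
def G (y : ℝ) : ℝ := (Real.exp (y - 1) - 1 / Real.exp 1) / (1 - 1 / Real.exp 1)

/-- An instance of online matching with additive budgets: a finite set `L` of offline vertices
with budgets `W i > 0`, and online vertices `0, 1, …, n - 1` listed in their order of arrival, with
edge weights `w i j ≥ 0`. A missing edge is an edge of weight `0`: assigning along it earns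
nothing, exactly like leaving the online vertex unassigned. -/
structure Instance (L : Type*) (n : ℕ) where
  w : L → Fin n → ℝ
  W : L → ℝ
  w_nonneg : ∀ i j, 0 ≤ w i j
  W_pos : ∀ i, 0 < W i

/-- An assignment sends every online vertex to at most one offline vertex. -/
abbrev Assignment (L : Type*) (n : ℕ) := Fin n → Option L

section

open scoped Classical

variable {L : Type*} [Fintype L] {n : ℕ}

/-- `R_max = max_{i,j} w_ij / W_i` (and `0` if there is no pair `(i, j)`). -/
def Instance.Rmax (I : Instance L n) : ℝ := ⨆ p : L × Fin n, I.w p.1 p.2 / I.W p.1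

/-- The total weight `∑_{j ∈ M_i} w_ij` of the online vertices that `M` assigns to `i`. -/
def Instance.load (I : Instance L n) (M : Assignment L n) (i : L) : ℝ :=
  ∑ j with M j = some i, I.w i j

/-- The reward `c(M) = ∑_i min {W_i, ∑_{j ∈ M_i} w_ij}`. -/
def Instance.reward (I : Instance L n) (M : Assignment L n) : ℝ :=
  ∑ i, min (I.W i) (I.load M i)

/-- The optimum (offline) reward, a maximum over the finitely many assignments. -/
def Instance.opt (I : Instance L n) : ℝ :=
  (Finset.univ : Finset (Assignment L n)).sup' ⟨fun _ => none, Finset.mem_univ _⟩ I.reward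

/-- What the algorithm maintains along a realization of its random choices: the realized
assignment `M` of the online vertices that have arrived (the others have the value `none`), and
the values of the variables `Y_i` and `B_i` under this realization. -/
structure State (L : Type*) (n : ℕ) where
  M : Assignment L n
  Y : L → ℝ
  B : L → ℝ

/-- Initially nothing is assigned and all variables are `0`. -/
def State.init (L : Type*) (n : ℕ) : State L n := ⟨fun _ => none, fun _ => 0, fun _ => 0⟩

/-- `min {w_ij, max {0, W_i - ∑_{j' assigned to i} w_ij'}}`, the increase of the reward if `j` is
assigned to `i` in the state `σ`. -/
def Instance.gain (I : Instance L n) (σ : State L n) (j : Fin n) (i : L) : ℝ :=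
  min (I.w i j) (max 0 (I.W i - I.load σ.M i))

/-- The quantity that selects the offline vertices for `j`:
`min {w_ij, max {0, W_i - ∑_{j' assigned to i} w_ij'}} * (1 - B_i / W_i)`. -/
def Instance.score (I : Instance L n) (σ : State L n) (j : Fin n) (i : L) : ℝ :=
  I.gain σ j i * (1 - σ.B i / I.W i)

/-- The offline vertices of maximal score for `j` in the state `σ`. -/
def Instance.argmaxSet (I : Instance L n) (σ : State L n) (j : Fin n) : Finset L :=
  {i | ∀ i', I.score σ j i' ≤ I.score σ j i}

theorem Instance.argmaxSet_nonempty (I : Instance L n) (σ : State L n) (j : Fin n)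
    (h : ∃ i, σ.Y i < 1) : (I.argmaxSet σ j).Nonempty := by
  obtain ⟨i₀, _⟩ := h
  obtain ⟨i, _, hi⟩ :=
    Finset.exists_max_image Finset.univ (I.score σ j) ⟨i₀, Finset.mem_univ _⟩
  exact ⟨i, by simpa [Instance.argmaxSet] using fun i' => hi i' (Finset.mem_univ _)⟩

/-- The random decision on `j`, given the realized state `σ` before its arrival. The
probabilities `x_ij` start at `0`. If some `Y_i < 1`, those of all `i` in the argmax set grow at
the same rate until `∑_i x_ij = 1`, so that `j` goes to a uniformly random element of that set;
if all `Y_i` are at least `1`, all `x_ij` stay `0` and `j` is left unassigned. -/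
def Instance.decision (I : Instance L n) (σ : State L n) (j : Fin n) : PMF (Option L) :=
  if h : ∃ i, σ.Y i < 1 then
    (PMF.uniformOfFinset (I.argmaxSet σ j) (I.argmaxSet_nonempty σ j h)).map some
  else PMF.pure none

/-- The state after the decision `o` on `j`. With `X_ij = 1` if `j` is assigned to `i` and
`X_ij = 0` otherwise, `Y_i` increases by `gain * X_ij / W_i`, and `B_i` follows the rule
`dB_i = gain * g(Y_i) dx` while the share `x` of `j` that `i` has received grows from `0` to `X_ij`
(and `Y_i` with it). -/
def Instance.update (I : Instance L n) (σ : State L n) (j : Fin n) (o : Option L) :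
    State L n where
  M := Function.update σ.M j o
  Y i := σ.Y i + I.gain σ j i / I.W i * (if o = some i then 1 else 0)
  B i := σ.B i + ∫ x in (0 : ℝ)..(if o = some i then 1 else 0),
    I.gain σ j i * g (σ.Y i + I.gain σ j i / I.W i * x)

/-- The treatment of one arriving online vertex `j`. -/
def Instance.step (I : Instance L n) (σ : State L n) (j : Fin n) : PMF (State L n) :=
  (I.decision σ j).map (I.update σ j)

/-- The law of the final assignment of the algorithm: the online vertices are treated in the order
`0, 1, …, n - 1`. -/
def Instance.algorithm (I : Instance L n) : PMF (Assignment L n) :=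
  ((List.finRange n).foldl (fun p j => p.bind fun σ => I.step σ j)
    (PMF.pure (State.init L n))).map State.M

/-- The expected reward of the algorithm. -/
def Instance.expectedReward (I : Instance L n) : ℝ :=
  ∑ M : Assignment L n, (I.algorithm M).toReal * I.reward M

end

end

end AdditiveBudget

namespace AdditiveBudget

open scoped Classical

open Finset

/-! The argument is primal-dual and pathwise: every realization attains the ratio, and all that
matters about a choice is that it maximizes the score. The offline dual is `W_i * G (Y_i)`, which
equals `B_i` because `G' = g`; the online dual `β j` is the maximal score when `j` arrives.

Write `R` for `Rmax`. Each step raises the dual objective by at most `(2 - e^{-R}) / (1 - 1/e)`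
times the increase of the reward (`dual_increase_le`). Scores only fall over time, so `β j`
dominates the final scores of `j`. These see weights truncated at the remaining budget, so the duals
cover only the fraction `1 - R / (4 (1 - 1/e))` of the reward of any assignment (`dual_covers`). For
`R ≤ 1` the quotient of the two constants is at least `e^{-R} - e^{-1}` (`ratio_bound`); for `R > 1`
the claimed ratio is negative. -/

/-! ### The functions `g` and `G`. -/

theorem one_sub_inv_exp_one_pos : 0 < 1 - 1 / Real.exp 1 := by
  rw [sub_pos, div_lt_one (Real.exp_pos 1)]
  exact Real.one_lt_exp_iff.2 one_pos

theorem G_zero : G 0 = 0 := by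
  simp [G, Real.exp_neg]

theorem G_one : G 1 = 1 := by
  simpa [G] using div_self one_sub_inv_exp_one_pos.ne'

theorem G_mono : Monotone G := by
  intro x y h
  have := one_sub_inv_exp_one_pos.le
  unfold G
  gcongr

theorem G_nonneg {y : ℝ} (h : 0 ≤ y) : 0 ≤ G y := G_zero ▸ G_mono h

theorem G_le_one {y : ℝ} (h : y ≤ 1) : G y ≤ 1 := G_one ▸ G_mono h

theorem hasDerivAt_G (y : ℝ) : HasDerivAt G (g y) y := by
  have h : HasDerivAt (fun y : ℝ => Real.exp (y - 1)) (Real.exp (y - 1)) y := by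
    simpa using ((hasDerivAt_id y).sub_const 1).exp
  exact (h.sub_const _).div_const _

theorem continuous_g : Continuous g := by
  unfold g
  fun_prop

/-- Chain rule with `G' = g`. This is what turns the update rule of `B_i` into the closed form `B_i
= W_i * G (Y_i)`. -/
theorem integral_g (W m y : ℝ) (hW : W ≠ 0) (t : ℝ) :
    ∫ x in (0 : ℝ)..t, m * g (y + m / W * x) = W * G (y + m / W * t) - W * G y := by
  have h : ∀ x : ℝ, HasDerivAt (fun x => W * G (y + m / W * x)) (m * g (y + m / W * x)) x := by
    intro x
    have h₁ : HasDerivAt (fun x : ℝ => y + m / W * x) (m / W) x := by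
      simpa using ((hasDerivAt_id x).const_mul (m / W)).const_add y
    have e : W * (g (y + m / W * x) * (m / W)) = m * g (y + m / W * x) := by field_simp
    exact e ▸ ((hasDerivAt_G _).comp x h₁).const_mul W
  rw [intervalIntegral.integral_eq_sub_of_hasDerivAt (fun x _ => h x)]
  · simp
  · have := continuous_g
    exact Continuous.intervalIntegrable (by fun_prop) _ _

/-! ### Scalar inequalities behind the ratio. -/

/-- The ratio between the increases of the dual and of the primal objective, at most
`(2 - e^{-R}) / (1 - 1/e)`. -/
theorem dual_increase_le {y δ R : ℝ} (hδ : 0 ≤ δ) (hδR : δ ≤ R) (hy : y + δ ≤ 1) :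
    G (y + δ) - G y + δ * (1 - G y) ≤ (2 - Real.exp (-R)) / (1 - 1 / Real.exp 1) * δ := by
  have hc := one_sub_inv_exp_one_pos
  have h₁ : Real.exp (y - 1) = Real.exp (y + δ - 1) * Real.exp (-δ) := by
    rw [← Real.exp_add]; ring_nf
  have h₂ : Real.exp (y + δ - 1) ≤ 1 := Real.exp_le_one_iff.2 (by linarith)
  have h₃ : 1 - δ ≤ Real.exp (-δ) := by linarith [Real.add_one_le_exp (-δ)]
  have h₄ : Real.exp (-R) ≤ Real.exp (-δ) := Real.exp_le_exp.2 (by linarith)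
  have h₅ : Real.exp (-δ) ≤ 1 := Real.exp_le_one_iff.2 (by linarith)
  have h₆ := Real.exp_pos (y + δ - 1)
  have key : Real.exp (y + δ - 1) * (1 - Real.exp (-δ)) +
      δ * (1 - Real.exp (y + δ - 1) * Real.exp (-δ)) ≤ (2 - Real.exp (-R)) * δ := by
    -- With `u = e^{y+δ-1}` and `v = e^{-δ}`, the left side is `u(1-v) + δ(1-u) + δu(1-v)`. The
    -- first two terms add up to at most `δ` by `a`, the last is at most `δ(1 - e^{-R})` by `b`.
    have a : Real.exp (y + δ - 1) * (1 - Real.exp (-δ)) ≤ Real.exp (y + δ - 1) * δ :=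
      mul_le_mul_of_nonneg_left (by linarith) h₆.le
    have b : Real.exp (y + δ - 1) * (1 - Real.exp (-δ)) ≤ 1 * (1 - Real.exp (-R)) :=
      mul_le_mul h₂ (by linarith) (by linarith) zero_le_one
    nlinarith [mul_le_mul_of_nonneg_left b hδ]
  have e : G (y + δ) - G y + δ * (1 - G y) = (Real.exp (y + δ - 1) * (1 - Real.exp (-δ)) +
      δ * (1 - Real.exp (y + δ - 1) * Real.exp (-δ))) / (1 - 1 / Real.exp 1) := by
    unfold G
    rw [h₁, eq_div_iff hc.ne']
    generalize Real.exp (y + δ - 1) = a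
    generalize Real.exp (-δ) = b
    generalize 1 / Real.exp 1 = d at hc ⊢
    have := hc.ne'
    field_simp
    ring
  rw [e, div_mul_eq_mul_div]
  exact div_le_div_of_nonneg_right key hc.le

theorem one_sub_G_le (y : ℝ) : 1 - G y ≤ (1 - y) / (1 - 1 / Real.exp 1) := by
  have hc := one_sub_inv_exp_one_pos
  have h : 1 - G y = (1 - Real.exp (y - 1)) / (1 - 1 / Real.exp 1) := by
    unfold G
    rw [eq_div_iff hc.ne', sub_mul, div_mul_cancel₀ _ hc.ne']
    ring
  rw [h]
  exact div_le_div_of_nonneg_right (by linarith [Real.add_one_le_exp (y - 1)]) hc.le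

/-- The dual variables of an offline vertex with final fill level `y`, together with those of the
online vertices `s`, cover the reward of assigning `s` to it, up to `1 - R / (4 (1 - 1/e))`. -/
theorem dual_covers {ι : Type*} (s : Finset ι) (w : ι → ℝ) {W y R : ℝ} (hW : 0 < W)
    (hy₀ : 0 ≤ y) (hy₁ : y ≤ 1) (hw : ∀ j, 0 ≤ w j) (hwR : ∀ j, w j ≤ R * W) (hR : 0 ≤ R) :
    (1 - R / (4 * (1 - 1 / Real.exp 1))) * min W (∑ j ∈ s, w j) ≤
      W * G y + ∑ j ∈ s, min (w j) (W * (1 - y)) * (1 - G y) := by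
  have hc := one_sub_inv_exp_one_pos
  have hG₀ := G_nonneg hy₀
  have hG₁ := G_le_one hy₁
  have hG₂ := one_sub_G_le y
  set c := 1 - 1 / Real.exp 1
  set V := min W (∑ j ∈ s, w j)
  have hV₀ : 0 ≤ V := le_min hW.le (sum_nonneg fun j _ => hw j)
  have hVW : V ≤ W := min_le_left _ _
  have hVs : V ≤ ∑ j ∈ s, w j := min_le_right _ _
  have hRc : 0 ≤ R / (4 * c) := by positivity
  rw [← sum_mul]
  have hWG : V * G y ≤ W * G y := mul_le_mul_of_nonneg_right hVW hG₀
  rcases le_or_gt R (1 - y) with h | h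
  -- No weight exceeds the remaining budget here, so nothing is truncated and nothing is lost.
  · have e : ∑ j ∈ s, min (w j) (W * (1 - y)) = ∑ j ∈ s, w j :=
      sum_congr rfl fun j _ => min_eq_left ((hwR j).trans (by nlinarith))
    rw [e]
    have := mul_le_mul_of_nonneg_right hVs (sub_nonneg.2 hG₁)
    nlinarith [mul_nonneg hRc hV₀]
  · have hR' : 0 < R := by linarith
    have hq₀ : 0 ≤ (1 - y) / R := div_nonneg (by linarith) hR
    have hq₁ : (1 - y) / R ≤ 1 := (div_le_one hR').2 h.le
    -- Truncation keeps at least the fraction `(1 - y) / R` of each weight, since `w j ≤ R * W`.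
    have h₁ : (1 - y) / R * V ≤ ∑ j ∈ s, min (w j) (W * (1 - y)) := by
      refine (mul_le_mul_of_nonneg_left hVs hq₀).trans ?_
      rw [mul_sum]
      refine sum_le_sum fun j _ => le_min (by nlinarith [hw j]) ?_
      calc (1 - y) / R * w j ≤ (1 - y) / R * (R * W) := mul_le_mul_of_nonneg_left (hwR j) hq₀
        _ = W * (1 - y) := by field_simp
    have h₂ := mul_le_mul_of_nonneg_right h₁ (sub_nonneg.2 hG₁)
    have h₃ : (1 - (1 - y) / R) * (1 - G y) ≤ R / (4 * c) := by
      refine (mul_le_mul_of_nonneg_left hG₂ (sub_nonneg.2 hq₁)).trans ?_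
      have e : (1 - (1 - y) / R) * ((1 - y) / c) = 4 * ((R - (1 - y)) * (1 - y)) / R / (4 * c) := by
        field_simp
      rw [e]
      refine div_le_div_of_nonneg_right ((div_le_iff₀ hR').2 ?_) (by positivity)
      -- AM-GM: `4 (R - t) t ≤ R ^ 2` for `t = 1 - y`; this is the source of the constant `4`.
      nlinarith [sq_nonneg (R - 2 * (1 - y))]
    nlinarith [mul_le_mul_of_nonneg_right h₃ hV₀]

/-- With `r = e^{-R}` and `d = e^{-1}`, one has `(r - d)(2 - r) = 1 - d - (1 - r)(1 + d - r)`, so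
the claim is `R / 4 ≤ (1 - r)(1 + d - r)`. It follows from `1 - r ≥ R / (1 + R)` and `d ≥ 1 / 4`. -/
theorem ratio_bound {R : ℝ} (hR₀ : 0 ≤ R) (hR₁ : R ≤ 1) :
    (Real.exp (-R) - Real.exp (-1)) * (2 - Real.exp (-R)) ≤
      (1 - 1 / Real.exp 1) * (1 - R / (4 * (1 - 1 / Real.exp 1))) := by
  have hc := one_sub_inv_exp_one_pos
  have e : (1 - 1 / Real.exp 1) * (1 - R / (4 * (1 - 1 / Real.exp 1))) =
      1 - Real.exp (-1) - R / 4 := by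
    rw [Real.exp_neg, ← one_div]
    generalize 1 / Real.exp 1 = d at hc ⊢
    have := hc.ne'
    field_simp
  rw [e]
  have ha : 1 / 4 ≤ Real.exp (-1) := by
    rw [Real.exp_neg, ← one_div]
    exact one_div_le_one_div_of_le (Real.exp_pos 1) (by linarith [Real.exp_one_lt_d9])
  have hr : Real.exp (-R) ≤ 1 / (1 + R) := by
    rw [Real.exp_neg, ← one_div]
    exact one_div_le_one_div_of_le (by linarith) (by linarith [Real.add_one_le_exp R])
  have hs : 1 - 1 / (1 + R) = R / (1 + R) := by field_simp; ring
  have hs₀ : 0 ≤ R / (1 + R) := by positivity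
  have h₁ : R / (1 + R) * (1 / 4 + R / (1 + R)) ≤
      (1 - Real.exp (-R)) * (1 + Real.exp (-1) - Real.exp (-R)) :=
    mul_le_mul (by linarith) (by linarith) (by positivity) (by linarith)
  have h₂ : R / 4 ≤ R / (1 + R) * (1 / 4 + R / (1 + R)) := by
    have e₂ : R / (1 + R) * (1 / 4 + R / (1 + R)) - R / 4 =
        R ^ 2 * (3 - R) / (4 * (1 + R) ^ 2) := by
      field_simp
      ring
    have : 0 ≤ R ^ 2 * (3 - R) / (4 * (1 + R) ^ 2) :=
      div_nonneg (mul_nonneg (sq_nonneg R) (by linarith)) (by positivity)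
    linarith
  nlinarith

/-! ### Loads, gains and rewards. -/

theorem min_add_eq_min_add_gain {W l w : ℝ} (hw : 0 ≤ w) :
    min W (l + w) = min W l + min w (max 0 (W - l)) := by
  rcases le_total W l with h | h
  · rw [min_eq_left h, min_eq_left (by linarith), max_eq_left (by linarith), min_eq_right hw,
      add_zero]
  · rw [min_eq_right h, max_eq_right (by linarith), ← min_add_add_left, min_comm, add_sub_cancel]

variable {L : Type*} {n : ℕ} (I : Instance L n)

theorem Instance.Rmax_nonneg : 0 ≤ I.Rmax :=
  Real.iSup_nonneg fun _ => div_nonneg (I.w_nonneg _ _) (I.W_pos _).le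

theorem Instance.load_nonneg (M : Assignment L n) (i : L) : 0 ≤ I.load M i :=
  sum_nonneg fun j _ => I.w_nonneg i j

theorem Instance.load_update {M : Assignment L n} {j : Fin n} (hj : M j = none) (o : Option L)
    (i : L) : I.load (Function.update M j o) i = I.load M i + if o = some i then I.w i j else 0 := by
  unfold Instance.load
  rw [sum_filter, sum_filter,
    ← Fintype.sum_ite_eq' j (fun _ => if o = some i then I.w i j else 0), ← sum_add_distrib]
  refine sum_congr rfl fun k _ => ?_
  by_cases h : k = j
  · subst h
    simp [hj]
  · simp [h]

variable [Fintype L]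

theorem Instance.le_Rmax (i : L) (j : Fin n) : I.w i j / I.W i ≤ I.Rmax :=
  le_ciSup (f := fun p : L × Fin n => I.w p.1 p.2 / I.W p.1) (Set.finite_range _).bddAbove (i, j)

theorem Instance.w_le (i : L) (j : Fin n) : I.w i j ≤ I.Rmax * I.W i :=
  (div_le_iff₀ (I.W_pos i)).1 (I.le_Rmax i j)

theorem Instance.reward_nonneg (M : Assignment L n) : 0 ≤ I.reward M :=
  sum_nonneg fun i _ => le_min (I.W_pos i).le (I.load_nonneg M i)

theorem Instance.opt_nonneg : 0 ≤ I.opt :=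
  (I.reward_nonneg fun _ => none).trans (le_sup' I.reward (mem_univ _))

/-! ### The primal-dual invariant. -/

/-- What holds for a state `σ` reached after the arrival of the online vertices in `S`, with dual
variables `β` for the online vertices. -/
structure Instance.Invariant (S : Finset (Fin n)) (σ : State L n) (β : Fin n → ℝ) : Prop where
  unassigned : ∀ j ∉ S, σ.M j = none
  fill : ∀ i, I.W i * σ.Y i = min (I.W i) (I.load σ.M i)
  dual : ∀ i, σ.B i = I.W i * G (σ.Y i)
  nonneg : ∀ j, 0 ≤ β j
  vanish : ∀ j ∉ S, β j = 0
  covers : ∀ j ∈ S, ∀ i, min (I.w i j) (I.W i * (1 - σ.Y i)) * (1 - G (σ.Y i)) ≤ β j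
  objective : ∑ j, β j + ∑ i, I.W i * G (σ.Y i) ≤
    (2 - Real.exp (-I.Rmax)) / (1 - 1 / Real.exp 1) * ∑ i, I.W i * σ.Y i

variable {I}

theorem Instance.Invariant.init : I.Invariant ∅ (State.init L n) 0 where
  unassigned _ _ := rfl
  fill i := by simp [State.init, Instance.load, (I.W_pos i).le]
  dual i := by simp [State.init, G_zero]
  nonneg _ := le_rfl
  vanish _ _ := rfl
  covers _ h := by simp at h
  objective := by simp [State.init, G_zero]

namespace Instance.Invariant

variable {S : Finset (Fin n)} {σ : State L n} {β : Fin n → ℝ}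

theorem Y_nonneg (h : I.Invariant S σ β) (i : L) : 0 ≤ σ.Y i := by
  have := h.fill i
  have h' : 0 ≤ I.W i * σ.Y i := this ▸ le_min (I.W_pos i).le (I.load_nonneg _ i)
  exact nonneg_of_mul_nonneg_right h' (I.W_pos i)

theorem Y_le_one (h : I.Invariant S σ β) (i : L) : σ.Y i ≤ 1 := by
  have h' : I.W i * σ.Y i ≤ I.W i * 1 := by
    rw [h.fill i, mul_one]
    exact min_le_left _ _
  exact le_of_mul_le_mul_left h' (I.W_pos i)

/-- By `fill` the remaining budget is `W_i (1 - Y_i)`, so gain and score depend on the state only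
through `Y_i`. -/
theorem gain_eq (h : I.Invariant S σ β) (j : Fin n) (i : L) :
    I.gain σ j i = min (I.w i j) (I.W i * (1 - σ.Y i)) := by
  rw [mul_sub, h.fill i, mul_one]
  unfold Instance.gain
  congr 1
  rcases le_total (I.W i) (I.load σ.M i) with h | h
  · rw [min_eq_left h, max_eq_left (by linarith), sub_self]
  · rw [min_eq_right h, max_eq_right (by linarith)]

theorem score_eq (h : I.Invariant S σ β) (j : Fin n) (i : L) :
    I.score σ j i = min (I.w i j) (I.W i * (1 - σ.Y i)) * (1 - G (σ.Y i)) := by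
  have := (I.W_pos i).ne'
  rw [Instance.score, h.gain_eq, h.dual, mul_div_cancel_left₀ _ this]

theorem gain_nonneg (h : I.Invariant S σ β) (j : Fin n) (i : L) : 0 ≤ I.gain σ j i := by
  rw [h.gain_eq]
  exact le_min (I.w_nonneg i j) (mul_nonneg (I.W_pos i).le (sub_nonneg.2 (h.Y_le_one i)))

theorem score_nonneg (h : I.Invariant S σ β) (j : Fin n) (i : L) : 0 ≤ I.score σ j i := by
  rw [h.score_eq, ← h.gain_eq]
  exact mul_nonneg (h.gain_nonneg j i) (sub_nonneg.2 (G_le_one (h.Y_le_one i)))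

theorem update_fill (h : I.Invariant S σ β) {j : Fin n} (hj : j ∉ S) (o : Option L) (i : L) :
    I.W i * (I.update σ j o).Y i = min (I.W i) (I.load (I.update σ j o).M i) := by
  have hW := (I.W_pos i).ne'
  simp only [Instance.update]
  rw [I.load_update (h.unassigned j hj)]
  split_ifs
  · rw [min_add_eq_min_add_gain (I.w_nonneg i j), ← h.fill i, Instance.gain]
    field_simp
  · simp [h.fill i]

theorem update_dual (h : I.Invariant S σ β) (j : Fin n) (o : Option L) (i : L) :
    (I.update σ j o).B i = I.W i * G ((I.update σ j o).Y i) := by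
  simp only [Instance.update]
  rw [integral_g _ _ _ (I.W_pos i).ne', h.dual i]
  ring

/-- The invariant is preserved if the dual variable of the arriving vertex is set to a value `b`
that dominates all scores and is paid for by the growth of the primal objective. -/
theorem update (h : I.Invariant S σ β) {j : Fin n} (hj : j ∉ S) (o : Option L) {b : ℝ}
    (hb : 0 ≤ b) (hmax : ∀ i, I.score σ j i ≤ b)
    (hobj : b + ∑ i, I.W i * (G ((I.update σ j o).Y i) - G (σ.Y i)) ≤
      (2 - Real.exp (-I.Rmax)) / (1 - 1 / Real.exp 1) *
        ∑ i, I.W i * ((I.update σ j o).Y i - σ.Y i)) :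
    I.Invariant (insert j S) (I.update σ j o) (Function.update β j b) where
  unassigned k hk := by
    simp only [mem_insert, not_or] at hk
    simpa [Instance.update, hk.1] using h.unassigned k hk.2
  fill := h.update_fill hj o
  dual := h.update_dual j o
  nonneg k := by
    by_cases hk : k = j
    · simpa [hk] using hb
    · simpa [hk] using h.nonneg k
  vanish k hk := by
    simp only [mem_insert, not_or] at hk
    simpa [hk.1] using h.vanish k hk.2
  covers k hk i := by
    have hmono : σ.Y i ≤ (I.update σ j o).Y i := by
      have := div_nonneg (h.gain_nonneg j i) (I.W_pos i).le
      simp only [Instance.update]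
      split_ifs <;> simp [this]
    have hle : (I.update σ j o).Y i ≤ 1 := by
      have h' : I.W i * (I.update σ j o).Y i ≤ I.W i * 1 := by
        rw [h.update_fill hj, mul_one]
        exact min_le_left _ _
      exact le_of_mul_le_mul_left h' (I.W_pos i)
    have hW := (I.W_pos i).le
    -- Both factors of the score decrease as `Y_i` grows, so constraints covered earlier stay
    -- covered.
    have key : min (I.w i k) (I.W i * (1 - (I.update σ j o).Y i)) *
        (1 - G ((I.update σ j o).Y i)) ≤
        min (I.w i k) (I.W i * (1 - σ.Y i)) * (1 - G (σ.Y i)) := by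
      refine mul_le_mul (min_le_min_left _ (mul_le_mul_of_nonneg_left (by linarith) hW))
        (by linarith [G_mono hmono]) (sub_nonneg.2 (G_le_one hle))
        (le_min (I.w_nonneg i k) (mul_nonneg hW (sub_nonneg.2 (h.Y_le_one i))))
    refine key.trans ?_
    by_cases hkj : k = j
    · subst hkj
      rw [Function.update_self, ← h.score_eq]
      exact hmax i
    · rw [Function.update_of_ne hkj]
      exact h.covers k ((mem_insert.1 hk).resolve_left hkj) i
  objective := by
    have hsum : ∑ k, Function.update β j b k = ∑ k, β k + b := by
      have h₁ := sum_update_of_mem (mem_univ j) β b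
      have h₂ := sum_eq_add_sum_sdiff_singleton_of_mem (mem_univ j) β
      rw [h.vanish j hj] at h₂
      linarith
    have h₀ := h.objective
    simp only [mul_sub, sum_sub_distrib] at hobj
    rw [hsum]
    linarith

theorem exists_of_mem_support_step (h : I.Invariant S σ β) {j : Fin n} (hj : j ∉ S)
    {τ : State L n} (hτ : τ ∈ (I.step σ j).support) :
    ∃ β', I.Invariant (insert j S) τ β' := by
  obtain ⟨o, ho, rfl⟩ := (PMF.mem_support_map_iff _ _ _).1 hτ
  unfold Instance.decision at ho
  split_ifs at ho with hex
  · obtain ⟨i, hi, rfl⟩ := (PMF.mem_support_map_iff _ _ _).1 ho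
    rw [PMF.mem_support_uniformOfFinset_iff] at hi
    simp only [Instance.argmaxSet, mem_filter, mem_univ, true_and] at hi
    refine ⟨_, h.update hj (some i) (h.score_nonneg j i) hi ?_⟩
    have hY : ∀ k, k ≠ i → (I.update σ j (some i)).Y k = σ.Y k := by
      intro k hk
      simp [Instance.update, hk.symm]
    have hYi : (I.update σ j (some i)).Y i = σ.Y i + I.gain σ j i / I.W i := by
      simp [Instance.update]
    have hW := I.W_pos i
    rw [Fintype.sum_eq_single i fun k hk => by rw [hY k hk]; simp,
      Fintype.sum_eq_single i fun k hk => by rw [hY k hk]; simp, hYi, h.score_eq, ← h.gain_eq]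
    have hδ := div_nonneg (h.gain_nonneg j i) hW.le
    have hδR : I.gain σ j i / I.W i ≤ I.Rmax :=
      (div_le_div_of_nonneg_right (min_le_left _ _) hW.le).trans (I.le_Rmax i j)
    have hδ₁ : σ.Y i + I.gain σ j i / I.W i ≤ 1 := by
      have : I.gain σ j i / I.W i ≤ 1 - σ.Y i := by
        rw [div_le_iff₀ hW, h.gain_eq, mul_comm (1 - σ.Y i)]
        exact min_le_right _ _
      linarith
    have key := mul_le_mul_of_nonneg_left (dual_increase_le hδ hδR hδ₁) hW.le
    have e : I.gain σ j i = I.W i * (I.gain σ j i / I.W i) := by field_simp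
    generalize I.gain σ j i / I.W i = δ at *
    rw [e]
    linarith
  · rw [PMF.mem_support_pure_iff] at ho
    subst ho
    push Not at hex
    -- All fill levels equal `1` and `G 1 = 1`, so every score vanishes and the new dual variable
    -- can be `0`.
    refine ⟨_, h.update hj none le_rfl (fun i => ?_) ?_⟩
    · rw [h.score_eq, le_antisymm (h.Y_le_one i) (hex i), G_one]
      simp
    · simp [Instance.update]

theorem reward_eq (h : I.Invariant S σ β) : I.reward σ.M = ∑ i, I.W i * σ.Y i :=
  sum_congr rfl fun i _ => (h.fill i).symm

/-- Weak duality at the end of the process. -/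
theorem reward_le_dual (h : I.Invariant univ σ β) (O : Assignment L n) :
    (1 - I.Rmax / (4 * (1 - 1 / Real.exp 1))) * I.reward O ≤
      ∑ j, β j + ∑ i, I.W i * G (σ.Y i) := by
  -- Each online vertex is counted for at most one `i`; for an unassigned one, `β j ≥ 0` suffices.
  have hβ : ∑ i, ∑ j with O j = some i, β j ≤ ∑ j, β j := by
    simp only [sum_filter]
    rw [sum_comm]
    refine sum_le_sum fun j _ => ?_
    cases hO : O j with
    | none => simpa using h.nonneg j
    | some i => simp
  refine le_trans ?_ (add_le_add_left hβ _)
  rw [← sum_add_distrib, Instance.reward, mul_sum]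
  refine sum_le_sum fun i _ => ?_
  rw [add_comm]
  refine (dual_covers _ (I.w i) (I.W_pos i) (h.Y_nonneg i) (h.Y_le_one i) (I.w_nonneg i)
    (I.w_le i) I.Rmax_nonneg).trans ?_
  exact add_le_add_right (sum_le_sum fun j _ => h.covers j (mem_univ j) i) _

theorem competitive (h : I.Invariant univ σ β) :
    (Real.exp (-I.Rmax) - Real.exp (-1)) * I.opt ≤ I.reward σ.M := by
  rcases le_or_gt I.Rmax 1 with hR | hR
  · obtain ⟨O, -, hO⟩ := exists_mem_eq_sup' (s := (univ : Finset (Assignment L n)))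
      ⟨fun _ => none, mem_univ _⟩ I.reward
    have hopt : I.opt = I.reward O := hO
    have hc := one_sub_inv_exp_one_pos
    have hr : Real.exp (-I.Rmax) ≤ 1 := Real.exp_le_one_iff.2 (by linarith [I.Rmax_nonneg])
    have h₁ := (h.reward_le_dual O).trans h.objective
    rw [← h.reward_eq, div_mul_eq_mul_div, le_div_iff₀ hc] at h₁
    have h₂ := mul_le_mul_of_nonneg_right (ratio_bound I.Rmax_nonneg hR) (I.reward_nonneg O)
    rw [hopt]
    refine le_of_mul_le_mul_left ?_ (show 0 < 2 - Real.exp (-I.Rmax) by linarith)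
    linarith
  · have : Real.exp (-I.Rmax) ≤ Real.exp (-1) := Real.exp_le_exp.2 (by linarith)
    exact (mul_nonpos_of_nonpos_of_nonneg (by linarith) I.opt_nonneg).trans (I.reward_nonneg _)

end Instance.Invariant

/-! ### From single steps to the law of the algorithm. -/

variable (I)

/-- The set `S` of earlier arrivals and the law `p` are arbitrary so that the induction on the list
goes through. The dual variables are chosen separately for each realization. -/
theorem Instance.exists_invariant_of_mem_support_foldl (l : List (Fin n)) :
    ∀ (S : Finset (Fin n)) (p : PMF (State L n)), l.Nodup → (∀ j ∈ l, j ∉ S) →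
      (∀ σ ∈ p.support, ∃ β, I.Invariant S σ β) →
      ∀ τ ∈ (l.foldl (fun p j => p.bind fun σ => I.step σ j) p).support,
        ∃ β, I.Invariant (S ∪ l.toFinset) τ β := by
  induction l with
  | nil =>
    intro S p _ _ hp τ hτ
    simpa using hp τ hτ
  | cons j l ih =>
    intro S p hl hS hp τ hτ
    rw [List.nodup_cons] at hl
    have := ih (insert j S) (p.bind fun σ => I.step σ j) hl.2 ?_ ?_ τ hτ
    · simpa [List.toFinset_cons, union_insert, insert_union] using this
    · intro k hk
      rw [mem_insert, not_or]
      exact ⟨fun e => hl.1 (e ▸ hk), hS k (List.mem_cons_of_mem _ hk)⟩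
    · intro ρ hρ
      obtain ⟨σ, hσ, hρσ⟩ := (PMF.mem_support_bind_iff _ _ _).1 hρ
      obtain ⟨β, h⟩ := hp σ hσ
      exact h.exists_of_mem_support_step (hS j List.mem_cons_self) hρσ

/-- Every realization of the algorithm satisfies the competitive ratio. -/
theorem Instance.competitive_of_mem_support {M : Assignment L n}
    (hM : M ∈ I.algorithm.support) :
    (Real.exp (-I.Rmax) - Real.exp (-1)) * I.opt ≤ I.reward M := by
  obtain ⟨σ, hσ, rfl⟩ := (PMF.mem_support_map_iff _ _ _).1 hM
  obtain ⟨β, h⟩ := I.exists_invariant_of_mem_support_foldl (List.finRange n) ∅ _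
    (List.nodup_finRange n) (by simp)
    (fun σ hσ => ⟨0, by
      rw [PMF.mem_support_pure_iff] at hσ
      exact hσ ▸ Instance.Invariant.init⟩) σ hσ
  have e : ∅ ∪ (List.finRange n).toFinset = univ := by
    ext j
    simp
  rw [e] at h
  exact h.competitive

end AdditiveBudget

theorem mainTheorem2 {L : Type*} [Fintype L] {n : ℕ} (I : AdditiveBudget.Instance L n) :
    AdditiveBudget.G (1 - I.Rmax) * (1 - 1 / Real.exp 1)
        = Real.exp (-I.Rmax) - Real.exp (-1) ∧
      AdditiveBudget.G (1 - I.Rmax) * (1 - 1 / Real.exp 1) * I.opt ≤ I.expectedReward := by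
  have hG : AdditiveBudget.G (1 - I.Rmax) * (1 - 1 / Real.exp 1)
      = Real.exp (-I.Rmax) - Real.exp (-1) := by
    rw [AdditiveBudget.G, div_mul_cancel₀ _ AdditiveBudget.one_sub_inv_exp_one_pos.ne',
      Real.exp_neg 1, one_div]
    ring_nf
  refine ⟨hG, ?_⟩
  rw [hG]
  have hsum : ∑ M, (I.algorithm M).toReal = 1 := by
    rw [← ENNReal.toReal_sum fun M _ => I.algorithm.apply_ne_top M,
      ← tsum_fintype (L := .unconditional _), I.algorithm.tsum_coe, ENNReal.toReal_one]
  calc (Real.exp (-I.Rmax) - Real.exp (-1)) * I.opt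
      = ∑ M, (I.algorithm M).toReal * ((Real.exp (-I.Rmax) - Real.exp (-1)) * I.opt) := by
        rw [← Finset.sum_mul, hsum, one_mul]
    _ ≤ I.expectedReward := by
        refine Finset.sum_le_sum fun M _ => ?_
        by_cases hM : M ∈ I.algorithm.support
        · exact mul_le_mul_of_nonneg_left (I.competitive_of_mem_support hM) ENNReal.toReal_nonneg
        · rw [PMF.mem_support_iff, not_not] at hM
          simp [hM]
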